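/- Let $\lambda>1$ and let $\mathcal T$ be the Galton–Watson tree with Poisson($\lambda$) offspring distribution, with root $\varnothing$ and law $\mathcal P$ (not conditioned on survival). For a realization of $\mathcal T$, let $\Delta_l$ be the set of vertices of the $l$-th generation, let $\mathbf P_y$ be the law of the discrete-time simple random walk on $\mathcal T$ started at the vertex $y$, and let $H_\varnothing=\inf\{n\ge 0 : X_n=\varnothing\}$ be the hitting time of the root by the walk. Then there exist constants $c_1>0$ and $c_2>0$, depending only on $\lambda$, such that for every integer $l\ge 1$ $$ \mathcal P\Big[\ \sup_{y\in\Delta_l}\mathbf P_y\big[H_\varnothing<\infty\big]\ \ge\ e^{-c_1 l}\ \Big]\ \le\ e^{-c_2 l}, $$ where the supremum over an empty set is $0$. -/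

import Mathlib

open MeasureTheory ProbabilityTheory
open scoped ENNReal NNReal

namespace SimpleGraph

/-! ### Discrete-time simple random walk on a locally finite graph -/

section RandomWalk

variable {V : Type*} (G : SimpleGraph V) [G.LocallyFinite]

/-- One-step law of the simple random walk at `x`: uniform on the neighbours of `x`
(a walk at an isolated vertex stays there). -/
noncomputable def walkStep (x : V) : PMF V :=
  open Classical in
  if h : (G.neighborFinset x).Nonempty then PMF.uniformOfFinset (G.neighborFinset x) h
  else PMF.pure x

variable [MeasurableSpace V] [DiscreteMeasurableSpace V]

/-- The transition kernel of the simple random walk, `x ↦ walkStep x`. -/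
noncomputable def walkKernel : Kernel V V where
  toFun x := (G.walkStep x).toMeasure
  measurable' := Measurable.of_discrete

instance isMarkovKernel_walkKernel : IsMarkovKernel G.walkKernel :=
  ⟨fun x => inferInstanceAs (IsProbabilityMeasure (G.walkStep x).toMeasure)⟩

/-- The law of the next position given the trajectory `X 0, …, X n`: it depends on `X n` only. -/
noncomputable def walkTransition (n : ℕ) :
    Kernel ((_i : Finset.Iic n) → V) V :=
  G.walkKernel.comap (fun p => p ⟨n, Finset.mem_Iic.2 le_rfl⟩) (measurable_pi_apply _)

instance isMarkovKernel_walkTransition (n : ℕ) : IsMarkovKernel (G.walkTransition n) :=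
  inferInstanceAs (IsMarkovKernel (G.walkKernel.comap _ _))

/-- The law, on the path space `ℕ → V`, of the discrete-time simple random walk on `G`
started at `y`. -/
noncomputable def walkLaw (y : V) : Measure (ℕ → V) :=
  Kernel.trajMeasure (X := fun _ => V) (Measure.dirac y) G.walkTransition

end RandomWalk

end SimpleGraph

/-- The hitting time `inf {n ≥ 0 : X n = x}` of the point `x` by the path `X`
(equal to `⊤` if `X` never visits `x`). -/
noncomputable def hittingTimeOf {V : Type*} (x : V) (X : ℕ → V) : ℕ∞ :=
  ⨅ (n : ℕ) (_ : X n = x), (n : ℕ∞)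

namespace GaltonWatson

/-! ### Galton–Watson trees

Individuals carry Ulam–Harris labels: the ancestor is `[]`, and `i :: u` is the `i`-th child of
the individual `u`, `i = 0, 1, …`. A configuration `ξ : List ℕ → ℕ` gives every label its number
of offspring. -/

/-- The label `u` belongs to the family tree of `ξ`: the `i`-th child of an individual `u`
of the tree is present if and only if `i < ξ u`. -/
def IsIndividual (ξ : List ℕ → ℕ) : List ℕ → Prop
  | [] => True
  | i :: u => i < ξ u ∧ IsIndividual ξ u

/-- The vertices of the family tree of `ξ`. -/
def Vertex (ξ : List ℕ → ℕ) : Type := {u : List ℕ // IsIndividual ξ u}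

variable (ξ : List ℕ → ℕ)

/-- The vertices carry the discrete σ-algebra. -/
instance : MeasurableSpace (Vertex ξ) := ⊤

instance : DiscreteMeasurableSpace (Vertex ξ) := ⟨fun _ => trivial⟩

instance : Countable (Vertex ξ) := inferInstanceAs (Countable {u : List ℕ // IsIndividual ξ u})

/-- The root of the tree. -/
def root : Vertex ξ := ⟨[], trivial⟩

variable {ξ} in
/-- The generation of a vertex. -/
def Vertex.generation (v : Vertex ξ) : ℕ := v.1.length

/-- The family tree of `ξ` as a graph: edges join each individual to its children. -/
def tree : SimpleGraph (Vertex ξ) where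
  Adj u v := (∃ i, v.1 = i :: u.1) ∨ (∃ i, u.1 = i :: v.1)
  symm := ⟨fun _ _ h => h.symm⟩
  loopless := ⟨fun u h => by
    rcases h with ⟨i, h⟩ | ⟨i, h⟩ <;> simpa using congrArg List.length h⟩

lemma tree_neighborSet_finite (u : Vertex ξ) : ((tree ξ).neighborSet u).Finite := by
  apply Set.Finite.of_finite_image (f := Subtype.val) _ Subtype.val_injective.injOn
  apply (((Set.finite_Iio (ξ u.1)).image (fun i => i :: u.1)).union
    (Set.finite_singleton u.1.tail)).subset
  rintro _ ⟨v, ⟨i, h⟩ | ⟨i, h⟩, rfl⟩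
  · left
    have hv : IsIndividual ξ v.1 := v.2
    rw [h] at hv
    exact ⟨i, hv.1, h.symm⟩
  · right
    simp [h]

noncomputable instance : (tree ξ).LocallyFinite :=
  fun u => (tree_neighborSet_finite ξ u).fintype

/-- The law of the Galton–Watson tree with Poisson(`r`) offspring: the numbers of offspring of
the labels are independent with the Poisson distribution of mean `r`. -/
noncomputable def poissonLaw (r : ℝ≥0) : Measure (List ℕ → ℕ) :=
  Measure.infinitePi (fun _ : List ℕ => poissonMeasure r)

/-- The probability that the simple random walk on the tree started at `y` ever hits the root. -/
noncomputable def hitRootProb (y : Vertex ξ) : ℝ≥0∞ :=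
  (tree ξ).walkLaw y {X | hittingTimeOf (root ξ) X < ⊤}

end GaltonWatson

namespace SimpleGraph

variable {V : Type*} (G : SimpleGraph V) [G.LocallyFinite]
  [MeasurableSpace V] [DiscreteMeasurableSpace V]

lemma lintegral_walkKernel_le (h : V → ℝ≥0∞) (v : V)
    (hv : ∑ w ∈ G.neighborFinset v, h w ≤ (G.neighborFinset v).card * h v) :
    ∫⁻ w, h w ∂(G.walkKernel v) ≤ h v := by
  classical
  change ∫⁻ w, h w ∂(G.walkStep v).toMeasure ≤ h v
  by_cases hne : (G.neighborFinset v).Nonempty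
  · have hstep : G.walkStep v = PMF.uniformOfFinset (G.neighborFinset v) hne := by
      simp only [walkStep, dif_pos hne]
    have hms : (G.walkStep v).toMeasure
        = Measure.sum fun w => (G.walkStep v w) • Measure.dirac w := by
      ext s hs
      rw [PMF.toMeasure_apply _ hs, Measure.sum_apply _ hs]
      refine tsum_congr fun w => ?_
      simp [Set.indicator_apply, Measure.dirac_apply' _ hs]
    rw [hms, lintegral_sum_measure]
    simp only [lintegral_smul_measure, lintegral_dirac, hstep, smul_eq_mul]
    rw [tsum_eq_sum (s := G.neighborFinset v)]
    · have : ∀ w ∈ G.neighborFinset v,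
          PMF.uniformOfFinset (G.neighborFinset v) hne w * h w
            = ((G.neighborFinset v).card : ℝ≥0∞)⁻¹ * h w := by
        intro w hw
        rw [PMF.uniformOfFinset_apply_of_mem _ hw]
      rw [Finset.sum_congr rfl this, ← Finset.mul_sum]
      refine (mul_le_mul_right hv _).trans ?_
      rw [← mul_assoc, ENNReal.inv_mul_cancel, one_mul]
      · exact_mod_cast hne.card_pos.ne'
      · exact ENNReal.natCast_ne_top _
    · intro w hw
      rw [PMF.uniformOfFinset_apply_of_notMem _ hw, zero_mul]
  · have hstep : G.walkStep v = PMF.pure v := by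
      simp only [walkStep, dif_neg hne]
    rw [hstep, PMF.toMeasure_pure, lintegral_dirac]

variable [Countable V]

/-- The event that the path `p` of length `n` has visited `x`. -/
def visits (x : V) {n : ℕ} (p : Finset.Iic n → V) : Prop := ∃ k, p k = x

open Classical in
/-- A function stopped at the value `1` once the path has visited `x`. -/
noncomputable def stopped (h : V → ℝ≥0∞) (x : V) (n : ℕ) (p : Finset.Iic n → V) : ℝ≥0∞ :=
  if visits x p then 1 else h (p ⟨n, Finset.mem_Iic.2 le_rfl⟩)

lemma lintegral_stopped_le {h : V → ℝ≥0∞} {x : V} (hx : 1 ≤ h x)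
    (hh : ∀ v, v ≠ x → ∫⁻ w, h w ∂(G.walkKernel v) ≤ h v) (y : V) (n : ℕ) :
    ∫⁻ X, stopped h x n (Preorder.frestrictLe n X) ∂(G.walkLaw y) ≤ h y := by
  classical
  induction n with
  | zero =>
    have h0 : ∀ X : ℕ → V, stopped h x 0 (Preorder.frestrictLe 0 X) ≤ h (X 0) := by
      intro X
      unfold stopped
      split_ifs with hv
      · obtain ⟨⟨k, hk⟩, hkx⟩ := hv
        have : k = 0 := by simpa using hk
        subst this
        have : X 0 = x := hkx
        rwa [this]
      · exact le_rfl
    refine (lintegral_mono h0).trans ?_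
    have hmap : (G.walkLaw y).map (fun X : ℕ → V => X 0) = Measure.dirac y := by
      have : (fun X : ℕ → V => X 0)
          = (fun p : (Finset.Iic 0 → V) => p ⟨0, by simp⟩) ∘ (Preorder.frestrictLe 0) := rfl
      rw [this, ← Measure.map_map (by fun_prop) (by fun_prop), walkLaw, Kernel.trajMeasure,
        Measure.map_comp _ _ (by fun_prop), Kernel.traj_map_frestrictLe, Kernel.partialTraj_self,
        Measure.id_comp, Measure.map_map (by fun_prop) (by fun_prop)]
      exact Measure.map_id
    rw [← lintegral_map (f := h) .of_discrete (measurable_pi_apply 0), hmap, lintegral_dirac]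
  | succ n ih =>
    refine le_trans ?_ ih
    let F : (Finset.Iic n → V) × V → ℝ≥0∞ :=
      fun q => if visits x q.1 ∨ q.2 = x then 1 else h q.2
    have h1 : ∀ X : ℕ → V, stopped h x (n + 1) (Preorder.frestrictLe (n + 1) X)
        = F (Preorder.frestrictLe n X, X (n + 1)) := by
      intro X
      have : visits x (Preorder.frestrictLe (n + 1) X)
          ↔ (visits x (Preorder.frestrictLe n X) ∨ X (n + 1) = x) := by
        constructor
        · rintro ⟨⟨k, hk⟩, hkx⟩
          rcases (Finset.mem_Iic.1 hk).lt_or_eq with hlt | rfl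
          · exact Or.inl ⟨⟨k, Finset.mem_Iic.2 (Nat.lt_succ_iff.1 hlt)⟩, hkx⟩
          · exact Or.inr hkx
        · rintro (⟨⟨k, hk⟩, hkx⟩ | hX)
          · exact ⟨⟨k, Finset.mem_Iic.2 ((Finset.mem_Iic.1 hk).trans n.le_succ)⟩, hkx⟩
          · exact ⟨⟨n + 1, Finset.mem_Iic.2 le_rfl⟩, hX⟩
      simp only [stopped, F, this]
      rfl
    have hF : Measurable F := .of_discrete
    have hmap : (G.walkLaw y).map (Preorder.frestrictLe n) ⊗ₘ G.walkTransition n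
        = (G.walkLaw y).map (fun X => (Preorder.frestrictLe n X, X (n + 1))) :=
      Kernel.map_frestrictLe_trajMeasure_compProd_eq_map_trajMeasure
    simp_rw [h1]
    rw [← lintegral_map hF (by fun_prop), ← hmap, Measure.lintegral_compProd hF,
      lintegral_map (hF.lintegral_kernel_prod_right') (by fun_prop)]
    refine lintegral_mono fun X => ?_
    change ∫⁻ w, F (Preorder.frestrictLe n X, w) ∂(G.walkKernel (X n)) ≤ _
    by_cases hv : visits x (Preorder.frestrictLe n X)
    · simp [F, stopped, hv]
    · have hXn : X n ≠ x := fun hX => hv ⟨⟨n, Finset.mem_Iic.2 le_rfl⟩, hX⟩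
      rw [stopped, if_neg hv]
      refine (lintegral_mono fun w => ?_).trans (hh _ hXn)
      simp only [F, hv, false_or]
      split_ifs with hw
      · rwa [hw]
      · exact le_rfl

/-- A nonnegative function that is superharmonic off `x` and at least `1` at `x` dominates the
probability of ever hitting `x`. -/
theorem walkLaw_hittingTimeOf_lt_top_le {h : V → ℝ≥0∞} {x : V} (hx : 1 ≤ h x)
    (hh : ∀ v, v ≠ x → ∫⁻ w, h w ∂(G.walkKernel v) ≤ h v) (y : V) :
    G.walkLaw y {X | hittingTimeOf x X < ⊤} ≤ h y := by
  classical
  have hset : {X : ℕ → V | hittingTimeOf x X < ⊤}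
      = ⋃ n : ℕ, {X | visits x (Preorder.frestrictLe n X)} := by
    ext X
    simp only [Set.mem_ofPred_eq, Set.mem_iUnion, hittingTimeOf, iInf_lt_iff, visits]
    constructor
    · rintro ⟨n, hn, -⟩
      exact ⟨n, ⟨n, Finset.mem_Iic.2 le_rfl⟩, hn⟩
    · rintro ⟨n, k, hk⟩
      exact ⟨k, hk, ENat.natCast_lt_top _⟩
  have hmono : Monotone fun n : ℕ => {X : ℕ → V | visits x (Preorder.frestrictLe n X)} := by
    rintro m n hmn X ⟨⟨k, hk⟩, hkx⟩
    exact ⟨⟨k, Finset.mem_Iic.2 ((Finset.mem_Iic.1 hk).trans hmn)⟩, hkx⟩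
  rw [hset, hmono.measure_iUnion]
  refine iSup_le fun n => ?_
  have hm : MeasurableSet {X : ℕ → V | visits x (Preorder.frestrictLe n X)} :=
    (MeasurableSet.of_discrete (s := {p | visits x p})).preimage
      (Preorder.measurable_frestrictLe (X := fun _ => V) n)
  rw [← lintegral_indicator_one hm]
  refine (lintegral_mono fun X => ?_).trans (G.lintegral_stopped_le hx hh y n)
  by_cases hv : visits x (Preorder.frestrictLe n X)
  · simp [stopped, hv]
  · simp [hv]

end SimpleGraph

namespace GaltonWatson

open Finset Filter Topology

/-- The configuration seen from the label `v`. -/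
def subtreeAt (v : List ℕ) (ξ : List ℕ → ℕ) : List ℕ → ℕ := fun u => ξ (u ++ v)

lemma subtreeAt_subtreeAt (u v : List ℕ) (ξ : List ℕ → ℕ) :
    subtreeAt u (subtreeAt v ξ) = subtreeAt (u ++ v) ξ := by
  ext w
  simp [subtreeAt]

lemma subtreeAt_root (v : List ℕ) (ξ : List ℕ → ℕ) : subtreeAt v ξ [] = ξ v := rfl

/-- The sum of a functional over the subtrees of the children of the root. -/
noncomputable def childSum (F : (List ℕ → ℕ) → ℝ≥0) (ξ : List ℕ → ℕ) : ℝ≥0 :=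
  ∑ i ∈ range (ξ []), F (subtreeAt [i] ξ)

/-- The effective conductance between the parent of the root and generation `n`, when the edges
above generation `n` have conductance `1` and those that lead to generation `n` have conductance
`a` and grounded lower ends. -/
noncomputable def conductanceTo (a : ℝ≥0) : ℕ → (List ℕ → ℕ) → ℝ≥0
  | 0, _ => a
  | n + 1, ξ => childSum (conductanceTo a n) ξ / (1 + childSum (conductanceTo a n) ξ)

/-- The effective conductance between the parent of the root and infinity. -/
noncomputable def conductance (ξ : List ℕ → ℕ) : ℝ≥0 := ⨅ n, conductanceTo 1 n ξ

lemma childSum_mono {F F' : (List ℕ → ℕ) → ℝ≥0} (h : ∀ ξ, F ξ ≤ F' ξ) (ξ : List ℕ → ℕ) :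
    childSum F ξ ≤ childSum F' ξ :=
  sum_le_sum fun _ _ => h _

lemma div_one_add_mono {s t : ℝ≥0} (h : s ≤ t) : s / (1 + s) ≤ t / (1 + t) := by
  rw [div_le_div_iff₀ (by positivity) (by positivity)]
  nlinarith

lemma div_one_add_le_one (s : ℝ≥0) : s / (1 + s) ≤ 1 :=
  div_le_one_of_le₀ le_add_self zero_le

lemma conductanceTo_mono {a b : ℝ≥0} (hab : a ≤ b) (n : ℕ) (ξ : List ℕ → ℕ) :
    conductanceTo a n ξ ≤ conductanceTo b n ξ := by
  induction n generalizing ξ with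
  | zero => exact hab
  | succ n ih => exact div_one_add_mono (childSum_mono ih ξ)

lemma conductanceTo_succ_le (n : ℕ) (ξ : List ℕ → ℕ) :
    conductanceTo 1 (n + 1) ξ ≤ conductanceTo 1 n ξ := by
  induction n generalizing ξ with
  | zero => exact div_one_add_le_one _
  | succ n ih => exact div_one_add_mono (childSum_mono ih ξ)

lemma antitone_conductanceTo (ξ : List ℕ → ℕ) : Antitone fun n => conductanceTo 1 n ξ :=
  antitone_nat_of_succ_le fun n => conductanceTo_succ_le n ξ

lemma tendsto_conductanceTo (ξ : List ℕ → ℕ) :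
    Tendsto (fun n => conductanceTo 1 n ξ) atTop (𝓝 (conductance ξ)) :=
  tendsto_atTop_ciInf (antitone_conductanceTo ξ) (OrderBot.bddBelow _)

lemma conductance_eq (ξ : List ℕ → ℕ) :
    conductance ξ = childSum conductance ξ / (1 + childSum conductance ξ) := by
  have h1 := (tendsto_conductanceTo ξ).comp (tendsto_add_atTop_nat 1)
  have h2 : Tendsto (fun n => childSum (conductanceTo 1 n) ξ) atTop
      (𝓝 (childSum conductance ξ)) :=
    tendsto_finsetSum _ fun i _ => tendsto_conductanceTo _
  have h3 := h2.div (h2.const_add 1) (by positivity)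
  exact tendsto_nhds_unique h1 h3

/-- The probability of ever hitting the parent, for the walk started at the root of a subtree. -/
noncomputable def hitParent (ξ : List ℕ → ℕ) : ℝ≥0 := (1 + childSum conductance ξ)⁻¹

lemma hitParent_le_one (ξ : List ℕ → ℕ) : hitParent ξ ≤ 1 :=
  inv_le_one_of_one_le₀ le_self_add

lemma hitParent_add_conductance (ξ : List ℕ → ℕ) : hitParent ξ + conductance ξ = 1 := by
  rw [hitParent, conductance_eq]
  field_simp

/-- The product over the ancestral line of `v`, the root excluded, of the probabilities to hit
the parent. -/
noncomputable def hitLine (ξ : List ℕ → ℕ) : List ℕ → ℝ≥0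
  | [] => 1
  | i :: u => hitLine ξ u * hitParent (subtreeAt (i :: u) ξ)

lemma hitLine_append (ξ : List ℕ → ℕ) (u : List ℕ) (i : ℕ) :
    hitLine ξ (u ++ [i]) = hitParent (subtreeAt [i] ξ) * hitLine (subtreeAt [i] ξ) u := by
  induction u with
  | nil => simp [hitLine]
  | cons j u ih => simp [hitLine, ih, subtreeAt_subtreeAt, mul_assoc]

lemma sum_children_hitLine (ξ : List ℕ → ℕ) (i : ℕ) (u : List ℕ) :
    hitLine ξ u + ∑ j ∈ range (ξ (i :: u)), hitLine ξ (j :: i :: u)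
      = (1 + ξ (i :: u)) * hitLine ξ (i :: u) := by
  have hS : childSum conductance (subtreeAt (i :: u) ξ)
      = ∑ j ∈ range (ξ (i :: u)), conductance (subtreeAt (j :: i :: u) ξ) := by
    simp only [childSum, subtreeAt_subtreeAt, subtreeAt_root, List.singleton_append]
  have h1 : hitLine ξ u
      = hitLine ξ (i :: u) * (1 + childSum conductance (subtreeAt (i :: u) ξ)) := by
    rw [hitLine, hitParent, mul_assoc, inv_mul_cancel₀ (by positivity), mul_one]
  have h2 : ∑ j ∈ range (ξ (i :: u)), hitLine ξ (j :: i :: u) =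
      hitLine ξ (i :: u) * ∑ j ∈ range (ξ (i :: u)), hitParent (subtreeAt (j :: i :: u) ξ) := by
    rw [mul_sum]
    rfl
  rw [h1, h2, hS, ← mul_add, add_assoc, ← sum_add_distrib]
  simp_rw [add_comm (conductance _), hitParent_add_conductance]
  simp [mul_comm]

/-- The label of a vertex. -/
def Vertex.label (ξ : List ℕ → ℕ) : Vertex ξ ↪ List ℕ :=
  ⟨fun v => v.1, Subtype.val_injective⟩

lemma Vertex.label_apply (ξ : List ℕ → ℕ) (v : Vertex ξ) : Vertex.label ξ v = v.1 := rfl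

lemma tree_adj (ξ : List ℕ → ℕ) (u v : Vertex ξ) :
    (tree ξ).Adj u v ↔ (∃ i, v.1 = i :: u.1) ∨ ∃ i, u.1 = i :: v.1 := Iff.rfl

lemma map_neighborFinset_tree (ξ : List ℕ → ℕ) {i : ℕ} {u : List ℕ}
    {v : Vertex ξ} (hv : v.1 = i :: u) :
    ((tree ξ).neighborFinset v).map (Vertex.label ξ)
      = insert u ((range (ξ (i :: u))).image fun j => j :: i :: u) := by
  ext w
  simp only [Finset.mem_map, SimpleGraph.mem_neighborFinset, tree_adj, Vertex.label_apply, mem_insert,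
    mem_image, mem_range]
  constructor
  · rintro ⟨⟨x, hx⟩, ⟨j, hj⟩ | ⟨j, hj⟩, rfl⟩
    · right
      change x = _ at hj
      subst hj
      exact ⟨j, hv ▸ hx.1, congrArg (j :: ·) hv.symm⟩
    · left
      rw [hv] at hj
      exact (List.cons_eq_cons.1 hj).2.symm
  · have hv' : IsIndividual ξ (i :: u) := hv ▸ v.2
    rintro (rfl | ⟨j, hj, rfl⟩)
    · exact ⟨⟨w, hv'.2⟩, Or.inr ⟨i, hv⟩, rfl⟩
    · exact ⟨⟨j :: i :: u, hj, hv'⟩, Or.inl ⟨j, by rw [hv]⟩, rfl⟩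

lemma sum_neighborFinset_tree (ξ : List ℕ → ℕ) {i : ℕ} {u : List ℕ}
    {v : Vertex ξ} (hv : v.1 = i :: u) {M : Type*} [AddCommMonoid M] (f : List ℕ → M) :
    ∑ w ∈ (tree ξ).neighborFinset v, f w.1
      = f u + ∑ j ∈ range (ξ (i :: u)), f (j :: i :: u) := by
  have h := sum_map ((tree ξ).neighborFinset v) (Vertex.label ξ) f
  rw [map_neighborFinset_tree ξ hv, sum_insert, sum_image] at h
  · exact h.symm
  · intro a _ b _ hab
    exact (List.cons_eq_cons.1 hab).1
  · simp only [mem_image, not_exists, not_and]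
    intro j _ hj
    have := congrArg List.length hj
    simp only [List.length_cons] at this
    omega

theorem hitRootProb_le (ξ : List ℕ → ℕ) (y : Vertex ξ) :
    hitRootProb ξ y ≤ hitLine ξ y.1 := by
  refine (tree ξ).walkLaw_hittingTimeOf_lt_top_le (h := fun v => (hitLine ξ v.1 : ℝ≥0∞))
    (by simp [root, hitLine]) ?_ y
  intro v hne
  obtain hv | ⟨i, u, hv⟩ : v.1 = [] ∨ ∃ i u, v.1 = i :: u := by
    cases v.1 <;> simp
  · exact absurd (Subtype.ext hv) hne
  · refine (tree ξ).lintegral_walkKernel_le _ _ (le_of_eq ?_)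
    have hcard := sum_neighborFinset_tree ξ hv (fun _ => 1)
    rw [sum_neighborFinset_tree ξ hv (fun w => (hitLine ξ w : ℝ≥0∞)), card_eq_sum_ones, hcard, hv]
    simpa using congrArg ((↑) : ℝ≥0 → ℝ≥0∞) (sum_children_hitLine ξ i u)

end GaltonWatson

/-- In a product space, a coordinate is independent of any family of other coordinates. -/
lemma ProbabilityTheory.indepFun_eval_infinitePi {ι α : Type*} {Ω : ι → Type*}
    [∀ i, MeasurableSpace (Ω i)] (P : ∀ i, Measure (Ω i)) [∀ i, IsProbabilityMeasure (P i)]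
    {i : ι} {f : α → ι} (hf : ∀ a, f a ≠ i) :
    IndepFun (fun ω : ∀ i, Ω i => ω i) (fun ω a => ω (f a)) (Measure.infinitePi P) := by
  have h := iIndepFun_infinitePi (P := P) (X := fun _ ω => ω) (fun _ => measurable_id)
  have hdisj : Disjoint {i} (Set.range f) := by
    rw [Set.disjoint_singleton_left]
    rintro ⟨a, ha⟩
    exact hf a ha
  have h' := indep_iSup_of_disjoint
    (fun j => (measurable_pi_apply (X := Ω) j).comap_le) h hdisj
  rw [IndepFun_iff_Indep]
  refine indep_of_indep_of_le_left (indep_of_indep_of_le_right h' ?_) ?_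
  · rw [MeasurableSpace.pi, MeasurableSpace.comap_iSup]
    refine iSup_le fun a => ?_
    rw [MeasurableSpace.comap_comp]
    exact le_iSup₂_of_le (f a) ⟨a, rfl⟩ le_rfl
  · exact le_iSup₂_of_le i rfl le_rfl

namespace ProbabilityTheory

lemma lintegral_poissonMeasure (r : ℝ≥0) (f : ℕ → ℝ≥0∞) :
    ∫⁻ n, f n ∂poissonMeasure r
      = ∑' n : ℕ, ENNReal.ofReal (Real.exp (-r) * r ^ n / n.factorial) * f n := by
  rw [poissonMeasure, lintegral_sum_measure]
  simp [lintegral_smul_measure, lintegral_dirac]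

/-- The size-biasing identity of the Poisson distribution. -/
lemma lintegral_mul_poissonMeasure (r : ℝ≥0) (f : ℕ → ℝ≥0∞) :
    ∫⁻ n, n * f (n - 1) ∂poissonMeasure r = r * ∫⁻ n, f n ∂poissonMeasure r := by
  rw [lintegral_poissonMeasure, lintegral_poissonMeasure, tsum_eq_zero_add' ENNReal.summable,
    ← ENNReal.tsum_mul_left]
  simp only [Nat.cast_zero, zero_mul, mul_zero, zero_add, Nat.add_sub_cancel]
  refine tsum_congr fun n => ?_
  rw [← mul_assoc, ← mul_assoc]
  congr 1
  rw [← ENNReal.ofReal_natCast (n + 1), ← ENNReal.ofReal_mul (by positivity),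
    ← ENNReal.ofReal_coe_nnreal, ← ENNReal.ofReal_mul (by positivity), Nat.factorial_succ]
  congr 1
  push_cast
  field_simp
  ring

/-- The probability generating function of the Poisson distribution. -/
lemma lintegral_pow_poissonMeasure (r s : ℝ≥0) :
    ∫⁻ n, (s : ℝ≥0∞) ^ n ∂poissonMeasure r = ENNReal.ofReal (Real.exp (r * (s - 1))) := by
  rw [lintegral_poissonMeasure]
  have hs : HasSum (fun n : ℕ => Real.exp (-r) * r ^ n / n.factorial * s ^ n)
      (Real.exp (r * (s - 1))) := by
    have h := (NormedSpace.expSeries_div_hasSum_exp ((r : ℝ) * s)).mul_left (Real.exp (-r))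
    rw [← Real.exp_eq_exp_ℝ, ← Real.exp_add] at h
    have h1 : (r * (s - 1) : ℝ) = -r + r * s := by ring
    have h2 : (fun n : ℕ => Real.exp (-r) * r ^ n / n.factorial * (s : ℝ) ^ n)
        = fun n : ℕ => Real.exp (-r) * ((r * s) ^ n / n.factorial) :=
      funext fun n => by rw [mul_pow]; ring
    rw [h1, h2]
    exact h
  rw [← hs.tsum_eq, ENNReal.ofReal_tsum_of_nonneg (fun n => by positivity) hs.summable]
  refine tsum_congr fun n => ?_
  rw [ENNReal.ofReal_mul (by positivity), ENNReal.ofReal_pow (by positivity),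
    ENNReal.ofReal_coe_nnreal]

end ProbabilityTheory

namespace GaltonWatson

open Finset Filter Topology

instance (r : ℝ≥0) : IsProbabilityMeasure (poissonLaw r) := by
  unfold poissonLaw
  infer_instance

@[fun_prop]
lemma measurable_subtreeAt (v : List ℕ) : Measurable (subtreeAt v) :=
  measurable_pi_lambda _ fun u => measurable_pi_apply (u ++ v)

/-- The number of children of the root, together with the subtrees of the possible children. -/
def offspring (ξ : List ℕ → ℕ) : ℕ × (ℕ → List ℕ → ℕ) := (ξ [], fun i => subtreeAt [i] ξ)

lemma measurable_offspring : Measurable offspring :=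
  (measurable_pi_apply []).prodMk (measurable_pi_lambda _ fun i => measurable_subtreeAt [i])

/-- The branching property: the subtrees of the children are independent copies of the tree,
independent of the number of children. -/
theorem map_offspring_poissonLaw (r : ℝ≥0) :
    (poissonLaw r).map offspring
      = (poissonMeasure r).prod (Measure.infinitePi fun _ : ℕ => poissonLaw r) := by
  let f : ℕ × List ℕ → List ℕ := fun p => p.2 ++ [p.1]
  have hf : Function.Injective f := by
    rintro ⟨i, u⟩ ⟨j, v⟩ h
    have := List.append_inj' h rfl
    simp_all
  have hne : ∀ p, f p ≠ [] := fun p => by simp [f]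
  have hind : IndepFun (fun ξ : List ℕ → ℕ => ξ []) (fun ξ p => ξ (f p)) (poissonLaw r) :=
    indepFun_eval_infinitePi _ hne
  have hmap : (poissonLaw r).map (fun ξ p => ξ (f p))
      = Measure.infinitePi fun _ : ℕ × List ℕ => poissonMeasure r :=
    Measure.map_infinitePi_infinitePi_of_inj hf
  have hind' := hind.comp measurable_id (MeasurableEquiv.curry ℕ (List ℕ) ℕ).measurable
  have hprod := (indepFun_iff_map_prod_eq_prod_map_map
    (measurable_id.comp (measurable_pi_apply [])).aemeasurable
    ((MeasurableEquiv.curry ℕ (List ℕ) ℕ).measurable.comp (by fun_prop)).aemeasurable).1 hind'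
  have h1 : (poissonLaw r).map (id ∘ fun ξ : List ℕ → ℕ => ξ []) = poissonMeasure r :=
    Measure.infinitePi_map_eval _ _
  have h2 : (poissonLaw r).map
      ((MeasurableEquiv.curry ℕ (List ℕ) ℕ) ∘ fun (ξ : List ℕ → ℕ) p => ξ (f p))
      = Measure.infinitePi fun _ : ℕ => poissonLaw r := by
    rw [← Measure.map_map (MeasurableEquiv.measurable _) (by fun_prop), hmap]
    exact Measure.infinitePi_map_curry fun (_ : ℕ) (_ : List ℕ) => poissonMeasure r
  rw [h1, h2] at hprod
  exact hprod

lemma lintegral_offspring (r : ℝ≥0) {f : ℕ × (ℕ → List ℕ → ℕ) → ℝ≥0∞} (hf : Measurable f) :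
    ∫⁻ ξ, f (offspring ξ) ∂poissonLaw r
      = ∫⁻ n, ∫⁻ ω, f (n, ω) ∂(Measure.infinitePi fun _ : ℕ => poissonLaw r)
          ∂poissonMeasure r := by
  rw [← lintegral_map hf measurable_offspring, map_offspring_poissonLaw,
    lintegral_prod _ hf.aemeasurable]

lemma measurable_sum_prod {M : Type*} [AddCommMonoid M] [MeasurableSpace M] [MeasurableAdd₂ M]
    {α : Type*} [MeasurableSpace α] {F : ℕ → α → M} (hF : ∀ i, Measurable (F i)) :
    Measurable fun p : ℕ × α => ∑ i ∈ range p.1, F i p.2 :=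
  measurable_from_prod_countable_right fun n => by
    dsimp only
    exact Finset.measurable_fun_sum _ fun i _ => hF i

lemma measurable_childSum {F : (List ℕ → ℕ) → ℝ≥0} (hF : Measurable F) :
    Measurable (childSum F) :=
  (measurable_sum_prod (F := fun i (ω : ℕ → List ℕ → ℕ) => F (ω i))
    fun i => by fun_prop).comp measurable_offspring

lemma lintegral_childSum (r : ℝ≥0) {F : (List ℕ → ℕ) → ℝ≥0} (hF : Measurable F)
    {g : ℝ≥0 → ℝ≥0∞} (hg : Measurable g) :
    ∫⁻ ξ, g (childSum F ξ) ∂poissonLaw r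
      = ∫⁻ n, ∫⁻ ω, g (∑ j ∈ range n, F (ω j))
          ∂(Measure.infinitePi fun _ : ℕ => poissonLaw r) ∂poissonMeasure r :=
  lintegral_offspring r (f := fun p => g (∑ j ∈ range p.1, F (p.2 j)))
    (hg.comp (measurable_sum_prod (F := fun i (ω : ℕ → List ℕ → ℕ) => F (ω i))
      fun i => by fun_prop))

lemma lintegral_sum_erase_mul (P : Measure (List ℕ → ℕ)) [IsProbabilityMeasure P]
    {F : (List ℕ → ℕ) → ℝ≥0} (hF : Measurable F)
    {g : ℝ≥0 → ℝ≥0∞} (hg : Measurable g) {T : (List ℕ → ℕ) → ℝ≥0∞} (hT : Measurable T)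
    {n i : ℕ} (hi : i < n + 1) :
    ∫⁻ ω, g (∑ j ∈ (range (n + 1)).erase i, F (ω j)) * T (ω i)
        ∂(Measure.infinitePi fun _ : ℕ => P)
      = (∫⁻ ω, g (∑ j ∈ range n, F (ω j)) ∂(Measure.infinitePi fun _ : ℕ => P)) *
        ∫⁻ ξ, T ξ ∂P := by
  let f : ℕ → ℕ := fun j => if j < i then j else j + 1
  have hf : Function.Injective f := by
    intro a b hab
    simp only [f] at hab
    split_ifs at hab <;> omega
  have hfi : ∀ j, f j ≠ i := by
    intro j
    simp only [f]
    split_ifs <;> omega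
  have hrange : (range (n + 1)).erase i = (range n).map ⟨f, hf⟩ := by
    ext j
    simp only [mem_erase, mem_range, Finset.mem_map, Function.Embedding.coeFn_mk, f]
    constructor
    · rintro ⟨h1, h2⟩
      by_cases hj : j < i
      · exact ⟨j, by omega, by simp [hj]⟩
      · refine ⟨j - 1, by omega, ?_⟩
        rw [if_neg (by omega)]
        omega
    · rintro ⟨k, hk, rfl⟩
      split_ifs <;> omega
  have hind := indepFun_eval_infinitePi (fun _ : ℕ => P) hfi
  have hG : Measurable fun ω : ℕ → List ℕ → ℕ => g (∑ j ∈ range n, F (ω j)) := by fun_prop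
  have hind' := (hind.comp hT hG).symm
  have h1 : ∀ ω : ℕ → List ℕ → ℕ, g (∑ j ∈ (range (n + 1)).erase i, F (ω j))
      = g (∑ j ∈ range n, F (ω (f j))) := by
    intro ω
    rw [hrange, sum_map]
    rfl
  have hmap : (Measure.infinitePi fun _ : ℕ => P).map (fun ω a => ω (f a))
      = Measure.infinitePi fun _ : ℕ => P :=
    Measure.map_infinitePi_infinitePi_of_inj hf
  simp_rw [h1]
  rw [← hmap, lintegral_map hG (by fun_prop), hmap,
    ← (measurePreserving_eval_infinitePi (fun _ : ℕ => P) i).lintegral_comp hT]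
  exact lintegral_mul_eq_lintegral_mul_lintegral_of_indepFun (by fun_prop) (by fun_prop) hind'

/-- The sum of a functional over the subtrees of the siblings of the child `i` of the root. -/
noncomputable def siblingSum (F : (List ℕ → ℕ) → ℝ≥0) (i : ℕ) (ξ : List ℕ → ℕ) : ℝ≥0 :=
  ∑ j ∈ (range (ξ [])).erase i, F (subtreeAt [j] ξ)

lemma measurable_sum_sibling {F : (List ℕ → ℕ) → ℝ≥0} (hF : Measurable F)
    {g : ℝ≥0 → ℝ≥0∞} (hg : Measurable g) {T : (List ℕ → ℕ) → ℝ≥0∞} (hT : Measurable T) :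
    Measurable fun p : ℕ × (ℕ → List ℕ → ℕ) =>
      ∑ i ∈ range p.1, g (∑ j ∈ (range p.1).erase i, F (p.2 j)) * T (p.2 i) :=
  measurable_from_prod_countable_right fun n => by dsimp only; fun_prop

/-- The spine decomposition: a sum over the children of the root, where each child is weighted by
a function of its siblings and a function of its own subtree. -/
theorem lintegral_sum_siblingSum_mul (r : ℝ≥0) {F : (List ℕ → ℕ) → ℝ≥0} (hF : Measurable F)
    {g : ℝ≥0 → ℝ≥0∞} (hg : Measurable g) {T : (List ℕ → ℕ) → ℝ≥0∞} (hT : Measurable T) :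
    ∫⁻ ξ, ∑ i ∈ range (ξ []), g (siblingSum F i ξ) * T (subtreeAt [i] ξ) ∂poissonLaw r
      = r * (∫⁻ ξ, g (childSum F ξ) ∂poissonLaw r) * ∫⁻ ξ, T ξ ∂poissonLaw r := by
  refine (lintegral_offspring r (measurable_sum_sibling hF hg hT)).trans ?_
  rw [lintegral_childSum r hF hg, ← lintegral_mul_poissonMeasure,
    ← lintegral_mul_const _ (by fun_prop)]
  refine lintegral_congr fun n => ?_
  dsimp only
  rw [lintegral_finsetSum _ (fun i _ => by fun_prop)]
  cases n with
  | zero => simp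
  | succ n =>
    rw [sum_congr rfl fun i hi =>
      lintegral_sum_erase_mul (poissonLaw r) hF hg hT (mem_range.1 hi)]
    simp [mul_assoc]

@[fun_prop]
lemma measurable_conductanceTo (a : ℝ≥0) (n : ℕ) : Measurable (conductanceTo a n) := by
  induction n with
  | zero => exact measurable_const
  | succ n ih =>
    have := measurable_childSum ih
    exact this.div (this.const_add 1)

@[fun_prop]
lemma measurable_conductance : Measurable conductance :=
  measurable_of_tendsto_metrizable (measurable_conductanceTo 1)
    (tendsto_pi_nhds.2 tendsto_conductanceTo)

lemma lintegral_sum_subtreeAt (r : ℝ≥0) {T : (List ℕ → ℕ) → ℝ≥0∞} (hT : Measurable T) :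
    ∫⁻ ξ, ∑ i ∈ range (ξ []), T (subtreeAt [i] ξ) ∂poissonLaw r
      = r * ∫⁻ ξ, T ξ ∂poissonLaw r := by
  have h := lintegral_sum_siblingSum_mul r (F := fun _ => 0) measurable_const
    (g := fun _ => 1) measurable_const hT
  simpa using h

lemma lintegral_coe_childSum (r : ℝ≥0) {F : (List ℕ → ℕ) → ℝ≥0} (hF : Measurable F) :
    ∫⁻ ξ, (childSum F ξ : ℝ≥0∞) ∂poissonLaw r = r * ∫⁻ ξ, (F ξ : ℝ≥0∞) ∂poissonLaw r := by
  rw [← lintegral_sum_subtreeAt r (by fun_prop)]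
  simp [childSum]

lemma lintegral_childSum_sq (r : ℝ≥0) {F : (List ℕ → ℕ) → ℝ≥0} (hF : Measurable F) :
    ∫⁻ ξ, (childSum F ξ : ℝ≥0∞) ^ 2 ∂poissonLaw r
      = r * ∫⁻ ξ, (F ξ : ℝ≥0∞) ^ 2 ∂poissonLaw r
        + (r * ∫⁻ ξ, (F ξ : ℝ≥0∞) ∂poissonLaw r) ^ 2 := by
  have hsq : ∀ ξ, (childSum F ξ : ℝ≥0∞) ^ 2
      = ∑ i ∈ range (ξ []), (F (subtreeAt [i] ξ) : ℝ≥0∞) ^ 2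
        + ∑ i ∈ range (ξ []), (siblingSum F i ξ : ℝ≥0∞) * F (subtreeAt [i] ξ) := by
    intro ξ
    rw [← sum_add_distrib, pow_two]
    nth_rw 2 [childSum]
    rw [ENNReal.ofNNReal_finsetSum, mul_sum]
    refine sum_congr rfl fun i hi => ?_
    have : childSum F ξ = F (subtreeAt [i] ξ) + siblingSum F i ξ :=
      (add_sum_erase _ (fun j => F (subtreeAt [j] ξ)) hi).symm
    rw [this, ENNReal.coe_add]
    ring
  have hmeas : Measurable fun ξ : List ℕ → ℕ =>
      ∑ i ∈ range (ξ []), (F (subtreeAt [i] ξ) : ℝ≥0∞) ^ 2 :=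
    (measurable_sum_prod (F := fun i (ω : ℕ → List ℕ → ℕ) => (F (ω i) : ℝ≥0∞) ^ 2)
      fun i => by fun_prop).comp measurable_offspring
  simp_rw [hsq]
  rw [lintegral_add_left hmeas, lintegral_sum_subtreeAt r (T := fun ξ => (F ξ : ℝ≥0∞) ^ 2)
    (by fun_prop), lintegral_sum_siblingSum_mul r hF (g := fun s => (s : ℝ≥0∞)) (by fun_prop)
    (T := fun ξ => (F ξ : ℝ≥0∞)) (by fun_prop), lintegral_coe_childSum r hF]
  ring

variable {r κ : ℝ≥0}

lemma lintegral_conductanceTo_le (r a : ℝ≥0) (n : ℕ) :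
    ∫⁻ ξ, (conductanceTo a n ξ : ℝ≥0∞) ∂poissonLaw r ≤ (a * r ^ n : ℝ≥0) := by
  induction n with
  | zero => simp [conductanceTo]
  | succ n ih =>
    have h : ∀ ξ, (conductanceTo a (n + 1) ξ : ℝ≥0∞) ≤ childSum (conductanceTo a n) ξ := by
      intro ξ
      exact_mod_cast div_le_self zero_le le_self_add
    refine (lintegral_mono h).trans ?_
    rw [lintegral_coe_childSum r (by fun_prop)]
    refine (mul_le_mul_right ih _).trans (le_of_eq ?_)
    rw [← ENNReal.coe_mul]
    congr 1
    ring

lemma lintegral_childSum_conductanceTo_sq_le (hκ1 : 1 ≤ κ) (hκ : κ * r + r ^ 2 ≤ κ * r ^ 2)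
    (a : ℝ≥0) (n : ℕ) :
    ∫⁻ ξ, (childSum (conductanceTo a n) ξ : ℝ≥0∞) ^ 2 ∂poissonLaw r
      ≤ (κ * (a * r ^ (n + 1)) ^ 2 : ℝ≥0) := by
  have key : ∀ n, ∫⁻ ξ, (conductanceTo a n ξ : ℝ≥0∞) ^ 2 ∂poissonLaw r
      ≤ (κ * (a * r ^ n) ^ 2 : ℝ≥0) →
      ∫⁻ ξ, (childSum (conductanceTo a n) ξ : ℝ≥0∞) ^ 2 ∂poissonLaw r
      ≤ (κ * (a * r ^ (n + 1)) ^ 2 : ℝ≥0) := by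
    intro n hn
    rw [lintegral_childSum_sq r (by fun_prop)]
    have h1 := lintegral_conductanceTo_le r a n
    calc _ ≤ (r : ℝ≥0∞) * (κ * (a * r ^ n) ^ 2 : ℝ≥0) + (r * (a * r ^ n : ℝ≥0)) ^ 2 := by gcongr
      _ = ((r * (κ * (a * r ^ n) ^ 2) + (r * (a * r ^ n)) ^ 2 : ℝ≥0) : ℝ≥0∞) := by push_cast; rfl
      _ ≤ _ := by
        refine ENNReal.coe_le_coe.2 ?_
        calc r * (κ * (a * r ^ n) ^ 2) + (r * (a * r ^ n)) ^ 2
            = (κ * r + r ^ 2) * (a * r ^ n) ^ 2 := by ring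
          _ ≤ κ * r ^ 2 * (a * r ^ n) ^ 2 := by gcongr
          _ = _ := by ring
  refine key n ?_
  induction n with
  | zero =>
    simp only [conductanceTo, lintegral_const, measure_univ, mul_one, pow_zero]
    exact_mod_cast le_mul_of_one_le_left zero_le hκ1
  | succ n ih =>
    refine (lintegral_mono fun ξ => ?_).trans (key n ih)
    have : conductanceTo a (n + 1) ξ ≤ childSum (conductanceTo a n) ξ :=
      div_le_self zero_le le_self_add
    gcongr

lemma le_lintegral_conductanceTo_add (hκ1 : 1 ≤ κ) (hκ : κ * r + r ^ 2 ≤ κ * r ^ 2)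
    (a : ℝ≥0) (n : ℕ) :
    ((a * r ^ n : ℝ≥0) : ℝ≥0∞) ≤ ∫⁻ ξ, (conductanceTo a n ξ : ℝ≥0∞) ∂poissonLaw r
      + (κ ^ 2 * (a * r ^ n) ^ 2 : ℝ≥0) := by
  induction n with
  | zero => simp [conductanceTo]
  | succ n ih =>
    have hs : ∀ s : ℝ≥0, s ≤ s / (1 + s) + s ^ 2 := by
      intro s
      calc s = s / (1 + s) + s ^ 2 / (1 + s) := by field_simp
        _ ≤ s / (1 + s) + s ^ 2 := by
          gcongr
          exact div_le_self zero_le le_self_add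
    have h1 : ∫⁻ ξ, (childSum (conductanceTo a n) ξ : ℝ≥0∞) ∂poissonLaw r
        ≤ ∫⁻ ξ, (conductanceTo a (n + 1) ξ : ℝ≥0∞) ∂poissonLaw r
          + (κ * (a * r ^ (n + 1)) ^ 2 : ℝ≥0) := by
      refine (lintegral_mono fun ξ => ?_).trans <| (lintegral_add_left (by fun_prop) _).le.trans
        (add_le_add_right (lintegral_childSum_conductanceTo_sq_le hκ1 hκ a n) _)
      have : childSum (conductanceTo a n) ξ
          ≤ conductanceTo a (n + 1) ξ + childSum (conductanceTo a n) ξ ^ 2 := hs _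
      exact (ENNReal.coe_le_coe.2 this).trans (by push_cast; exact le_rfl)
    rw [lintegral_coe_childSum r (by fun_prop)] at h1
    calc ((a * r ^ (n + 1) : ℝ≥0) : ℝ≥0∞) = r * (a * r ^ n : ℝ≥0) := by
          rw [← ENNReal.coe_mul]
          congr 1
          ring
      _ ≤ r * (∫⁻ ξ, (conductanceTo a n ξ : ℝ≥0∞) ∂poissonLaw r
            + (κ ^ 2 * (a * r ^ n) ^ 2 : ℝ≥0)) := by gcongr
      _ = r * ∫⁻ ξ, (conductanceTo a n ξ : ℝ≥0∞) ∂poissonLaw r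
            + (r * (κ ^ 2 * (a * r ^ n) ^ 2) : ℝ≥0) := by rw [mul_add, ENNReal.coe_mul r]
      _ ≤ ∫⁻ ξ, (conductanceTo a (n + 1) ξ : ℝ≥0∞) ∂poissonLaw r
          + (κ * (a * r ^ (n + 1)) ^ 2 : ℝ≥0) + (r * (κ ^ 2 * (a * r ^ n) ^ 2) : ℝ≥0) := by gcongr
      _ ≤ _ := by
        rw [add_assoc, ← ENNReal.coe_add]
        gcongr
        calc κ * (a * r ^ (n + 1)) ^ 2 + r * (κ ^ 2 * (a * r ^ n) ^ 2)
            = κ * (κ * r + r ^ 2) * (a * r ^ n) ^ 2 := by ring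
          _ ≤ κ * (κ * r ^ 2) * (a * r ^ n) ^ 2 := by gcongr
          _ = _ := by ring

/-- The tree is transient with positive probability. -/
theorem lintegral_conductance_pos (hr : 1 < r) :
    0 < ∫⁻ ξ, (conductance ξ : ℝ≥0∞) ∂poissonLaw r := by
  have hr0 : 0 < r := zero_lt_one.trans hr
  obtain ⟨κ, hκ1, hκ⟩ : ∃ κ : ℝ≥0, 1 ≤ κ ∧ κ * r + r ^ 2 ≤ κ * r ^ 2 := by
    obtain ⟨d, rfl⟩ := exists_add_of_le hr.le
    have hd : 0 < d := by simpa using hr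
    refine ⟨(1 + d) / d, ?_, le_of_eq ?_⟩
    · rw [one_le_div₀ hd]
      exact le_add_self
    · field_simp
  set ε : ℝ≥0 := 1 / (2 * κ ^ 2) with hε
  have hε0 : 0 < ε := by positivity
  have hε1 : ε ≤ 1 := by
    rw [hε, div_le_one₀ (by positivity)]
    nlinarith [one_le_pow₀ hκ1 (n := 2)]
  have hεκ : κ ^ 2 * ε ^ 2 = ε / 2 := by
    rw [hε]
    field_simp
  have hlow : ∀ n, ((ε / 2 : ℝ≥0) : ℝ≥0∞)
      ≤ ∫⁻ ξ, (conductanceTo 1 n ξ : ℝ≥0∞) ∂poissonLaw r := by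
    intro n
    have h := le_lintegral_conductanceTo_add hκ1 hκ (ε / r ^ n) n
    rw [div_mul_cancel₀ _ (by positivity), hεκ] at h
    have h2 : ((ε : ℝ≥0) : ℝ≥0∞) = (ε / 2 : ℝ≥0) + (ε / 2 : ℝ≥0) := by
      rw [← ENNReal.coe_add, add_halves]
    rw [h2] at h
    refine (ENNReal.le_of_add_le_add_right ENNReal.coe_ne_top h).trans ?_
    refine lintegral_mono fun ξ => ?_
    have : ε / r ^ n ≤ 1 := div_le_one_of_le₀ (hε1.trans (one_le_pow₀ hr.le)) zero_le
    exact ENNReal.coe_le_coe.2 (conductanceTo_mono this n ξ)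
  have hlim : Tendsto (fun n => ∫⁻ ξ, (conductanceTo 1 n ξ : ℝ≥0∞) ∂poissonLaw r) atTop
      (𝓝 (∫⁻ ξ, (conductance ξ : ℝ≥0∞) ∂poissonLaw r)) := by
    refine tendsto_lintegral_of_dominated_convergence (fun _ => 1) (fun n => by fun_prop)
      (fun n => ?_) (by simp) ?_
    · refine Eventually.of_forall fun ξ => ?_
      exact ENNReal.coe_le_coe.2 (antitone_conductanceTo ξ (Nat.zero_le n))
    · exact Eventually.of_forall fun ξ =>
        (ENNReal.continuous_coe.tendsto _).comp (tendsto_conductanceTo ξ)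
  exact lt_of_lt_of_le (by exact_mod_cast half_pos hε0) (ge_of_tendsto' hlim hlow)

lemma conductance_eq_zero_iff (ξ : List ℕ → ℕ) :
    conductance ξ = 0 ↔ childSum conductance ξ = 0 := by
  rw [conductance_eq, div_eq_zero_iff]
  simp

/-- The probability that the tree is recurrent is a fixed point of the offspring generating
function. -/
lemma measure_conductance_eq_zero (r : ℝ≥0) :
    poissonLaw r {ξ | conductance ξ = 0}
      = ENNReal.ofReal (Real.exp (r * ((poissonLaw r).real {ξ | conductance ξ = 0} - 1))) := by
  have hm : MeasurableSet {ξ : List ℕ → ℕ | conductance ξ = 0} :=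
    measurable_conductance (measurableSet_singleton 0)
  have h0 : poissonLaw r {ξ | conductance ξ = 0}
      = ∫⁻ ξ, ({0} : Set ℝ≥0).indicator 1 (childSum conductance ξ) ∂poissonLaw r := by
    rw [← lintegral_indicator_one hm]
    refine lintegral_congr fun ξ => ?_
    simp only [Set.indicator_apply, Set.mem_ofPred_eq, Set.mem_singleton_iff,
      conductance_eq_zero_iff, Pi.one_apply]
  have h1 : ∀ n : ℕ, ∫⁻ ω : ℕ → List ℕ → ℕ,
      ({0} : Set ℝ≥0).indicator 1 (∑ j ∈ range n, conductance (ω j))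
        ∂(Measure.infinitePi fun _ : ℕ => poissonLaw r)
      = (((poissonLaw r) {ξ | conductance ξ = 0}).toNNReal : ℝ≥0∞) ^ n := by
    intro n
    have hset : MeasurableSet (Set.pi (range n : Set ℕ)
        fun _ => {ξ : List ℕ → ℕ | conductance ξ = 0}) :=
      MeasurableSet.pi (Finset.countable_toSet _) fun _ _ => hm
    rw [ENNReal.coe_toNNReal (measure_ne_top _ _)]
    have := Measure.infinitePi_pi (fun _ : ℕ => poissonLaw r) (s := range n)
      (t := fun _ => {ξ : List ℕ → ℕ | conductance ξ = 0}) fun _ _ => hm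
    rw [prod_const, card_range] at this
    rw [← this, ← lintegral_indicator_one hset]
    refine lintegral_congr fun ω => ?_
    classical
    have hiff : ω ∈ Set.pi (range n : Set ℕ) (fun _ => {ξ : List ℕ → ℕ | conductance ξ = 0})
        ↔ ∑ j ∈ range n, conductance (ω j) ∈ ({0} : Set ℝ≥0) := by
      rw [Set.mem_singleton_iff, sum_eq_zero_iff]
      rfl
    simp only [Set.indicator_apply, hiff, Pi.one_apply]
  rw [h0, lintegral_childSum r measurable_conductance
    (measurable_one.indicator (measurableSet_singleton 0))]
  simp_rw [h1]
  rw [lintegral_pow_poissonMeasure]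
  rfl

lemma measureReal_conductance_eq_zero_lt_one (hr : 1 < r) :
    (poissonLaw r).real {ξ | conductance ξ = 0} < 1 := by
  have hm : MeasurableSet {ξ : List ℕ → ℕ | conductance ξ = 0} :=
    measurable_conductance (measurableSet_singleton 0)
  refine lt_of_le_of_ne measureReal_le_one fun h => ?_
  have h1 : poissonLaw r {ξ | conductance ξ = 0} = 1 := by
    rw [← ofReal_measureReal, h, ENNReal.ofReal_one]
  have hae : ∀ᵐ ξ ∂poissonLaw r, conductance ξ = 0 := (prob_compl_eq_zero_iff hm).2 h1
  have := lintegral_conductance_pos hr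
  rw [lintegral_congr_ae (g := fun _ => 0) (hae.mono fun ξ h => by simp [h])] at this
  simp at this

/-- The mean number of children that have no sibling with a transient subtree is less than one. -/
lemma mul_measureReal_conductance_eq_zero_lt_one (hr : 1 < r) :
    (r : ℝ) * (poissonLaw r).real {ξ | conductance ξ = 0} < 1 := by
  set p := (poissonLaw r).real {ξ | conductance ξ = 0} with hp
  have hp1 : p < 1 := measureReal_conductance_eq_zero_lt_one hr
  have hfix : p = Real.exp (r * (p - 1)) := by
    have h := congrArg ENNReal.toReal (measure_conductance_eq_zero r)
    rwa [ENNReal.toReal_ofReal (Real.exp_pos _).le] at h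
  have hp0 : 0 < p := hfix ▸ Real.exp_pos _
  have hlog : Real.log p = r * (p - 1) := by
    conv_lhs => rw [hfix]
    exact Real.log_exp _
  have h := Real.log_lt_sub_one_of_pos (inv_pos.2 hp0) (by simpa using hp1.ne)
  rw [Real.log_inv, hlog] at h
  have h2 : r * (1 - p) * p < 1 - p := by
    have := mul_lt_mul_of_pos_right h hp0
    rw [sub_mul, inv_mul_cancel₀ hp0.ne'] at this
    linarith
  nlinarith [sub_pos.2 hp1]

/-- The moment of order `k` of the probability to hit the parent of the root. -/
noncomputable def hitMoment (r : ℝ≥0) (k : ℕ) : ℝ≥0∞ :=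
  ∫⁻ ξ, (((1 + childSum conductance ξ)⁻¹ ^ k : ℝ≥0) : ℝ≥0∞) ∂poissonLaw r

lemma tendsto_hitMoment (r : ℝ≥0) :
    Tendsto (hitMoment r) atTop (𝓝 (poissonLaw r {ξ | conductance ξ = 0})) := by
  have hm : MeasurableSet {ξ : List ℕ → ℕ | conductance ξ = 0} :=
    measurable_conductance (measurableSet_singleton 0)
  have hmc := measurable_childSum measurable_conductance
  rw [← lintegral_indicator_one hm]
  refine tendsto_lintegral_of_dominated_convergence (fun _ => 1) (fun n => by fun_prop)
    (fun n => ?_) (by simp) ?_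
  · refine Eventually.of_forall fun ξ => ?_
    exact ENNReal.coe_le_one_iff.2 (pow_le_one₀ zero_le (hitParent_le_one ξ))
  · refine Eventually.of_forall fun ξ => ?_
    by_cases h : conductance ξ = 0
    · have h' := (conductance_eq_zero_iff ξ).1 h
      simp [h, h']
    · have h' := mt (conductance_eq_zero_iff ξ).2 h
      have hlt : (1 + childSum conductance ξ)⁻¹ < 1 :=
        inv_lt_one_of_one_lt₀ (by simpa using pos_iff_ne_zero.2 h')
      have := NNReal.tendsto_pow_atTop_nhds_zero_of_lt_one hlt
      have h0 : ({ξ | conductance ξ = 0} : Set (List ℕ → ℕ)).indicator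
          (1 : (List ℕ → ℕ) → ℝ≥0∞) ξ = (0 : ℝ≥0) := by simp [h]
      rw [h0]
      exact (ENNReal.continuous_coe.tendsto _).comp this

lemma exists_mul_hitMoment_lt_one (hr : 1 < r) :
    ∃ k : ℕ, 0 < k ∧ r * hitMoment r k < 1 := by
  have hlim : Tendsto (fun k => r * hitMoment r k) atTop
      (𝓝 (r * poissonLaw r {ξ | conductance ξ = 0})) :=
    ENNReal.Tendsto.const_mul (tendsto_hitMoment r) (Or.inr ENNReal.coe_ne_top)
  have hlt : r * poissonLaw r {ξ | conductance ξ = 0} < 1 := by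
    rw [← ofReal_measureReal, ← ENNReal.ofReal_coe_nnreal, ← ENNReal.ofReal_mul (NNReal.coe_nonneg r)]
    exact ENNReal.ofReal_lt_one.2 (mul_measureReal_conductance_eq_zero_lt_one hr)
  obtain ⟨k, hk, hk0⟩ := ((hlim.eventually_lt_const hlt).and (eventually_gt_atTop 0)).exists
  exact ⟨k, hk0, hk⟩

/-- The sum over the vertices of generation `n` of the product, over the strict ancestors, of
the weights `(1 + s)⁻¹ ^ k`, with `s` the total conductance of the branches that leave the
ancestral line. -/
noncomputable def lineSum (k : ℕ) : ℕ → (List ℕ → ℕ) → ℝ≥0∞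
  | 0, _ => 1
  | n + 1, ξ => ∑ i ∈ range (ξ []),
      (((1 + siblingSum conductance i ξ)⁻¹ ^ k : ℝ≥0) : ℝ≥0∞) * lineSum k n (subtreeAt [i] ξ)

@[fun_prop]
lemma measurable_lineSum (k n : ℕ) : Measurable (lineSum k n) := by
  induction n with
  | zero => exact measurable_const
  | succ n ih =>
    have hg : Measurable fun s : ℝ≥0 => (((1 + s)⁻¹ ^ k : ℝ≥0) : ℝ≥0∞) := by fun_prop
    have h := (measurable_sum_sibling measurable_conductance hg ih).comp measurable_offspring
    have heq : lineSum k (n + 1) = (fun p : ℕ × (ℕ → List ℕ → ℕ) =>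
        ∑ i ∈ range p.1, (((1 + ∑ j ∈ (range p.1).erase i, conductance (p.2 j))⁻¹ ^ k : ℝ≥0)
          : ℝ≥0∞) * lineSum k n (p.2 i)) ∘ offspring := by
      ext ξ
      rfl
    rw [heq]
    exact h

lemma lintegral_lineSum (r : ℝ≥0) (k n : ℕ) :
    ∫⁻ ξ, lineSum k n ξ ∂poissonLaw r = (r * hitMoment r k) ^ n := by
  induction n with
  | zero => simp [lineSum]
  | succ n ih =>
    rw [pow_succ', ← ih]
    exact lintegral_sum_siblingSum_mul r measurable_conductance
      (g := fun s => (((1 + s)⁻¹ ^ k : ℝ≥0) : ℝ≥0∞)) (by fun_prop) (measurable_lineSum k n)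

lemma isIndividual_append (ξ : List ℕ → ℕ) (u : List ℕ) (i : ℕ) :
    IsIndividual ξ (u ++ [i]) ↔ i < ξ [] ∧ IsIndividual (subtreeAt [i] ξ) u := by
  induction u with
  | nil => simp [IsIndividual]
  | cons j u ih =>
    simp only [List.cons_append, IsIndividual, ih, subtreeAt]
    tauto

lemma hitParent_le_siblingSum (ξ : List ℕ → ℕ) (i : ℕ) :
    hitParent ξ ≤ (1 + siblingSum conductance i ξ)⁻¹ := by
  refine inv_anti₀ (by positivity) ?_
  gcongr
  exact sum_le_sum_of_subset (erase_subset _ _)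

lemma hitParent_mul_hitLine_pow_le (k n : ℕ) (ξ : List ℕ → ℕ) (v : List ℕ)
    (hv : IsIndividual ξ v) (hn : v.length = n) :
    (((hitParent ξ * hitLine ξ v) ^ k : ℝ≥0) : ℝ≥0∞) ≤ lineSum k n ξ := by
  induction n generalizing ξ v with
  | zero =>
    obtain rfl := List.length_eq_zero_iff.1 hn
    simp only [hitLine, mul_one, lineSum]
    exact_mod_cast pow_le_one₀ zero_le (hitParent_le_one ξ)
  | succ n ih =>
    obtain rfl | ⟨u, i, rfl⟩ := v.eq_nil_or_concat
    · simp at hn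
    rw [List.concat_eq_append] at *
    obtain ⟨hi, hu⟩ := (isIndividual_append ξ u i).1 hv
    rw [hitLine_append, mul_pow, ENNReal.coe_mul]
    refine le_trans ?_ (single_le_sum_of_canonicallyOrdered (f := fun i =>
      (((1 + siblingSum conductance i ξ)⁻¹ ^ k : ℝ≥0) : ℝ≥0∞) * lineSum k n (subtreeAt [i] ξ))
      (mem_range.2 hi))
    have hw := hitParent_le_siblingSum ξ i
    have hu' := ih (subtreeAt [i] ξ) u hu (by simpa using hn)
    gcongr

lemma hitLine_pow_le (k n : ℕ) (ξ : List ℕ → ℕ) (v : List ℕ)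
    (hv : IsIndividual ξ v) (hn : v.length = n + 1) :
    ((hitLine ξ v ^ k : ℝ≥0) : ℝ≥0∞) ≤ ∑ i ∈ range (ξ []), lineSum k n (subtreeAt [i] ξ) := by
  obtain rfl | ⟨u, i, rfl⟩ := v.eq_nil_or_concat
  · simp at hn
  rw [List.concat_eq_append] at *
  obtain ⟨hi, hu⟩ := (isIndividual_append ξ u i).1 hv
  rw [hitLine_append]
  exact (hitParent_mul_hitLine_pow_le k n _ u hu (by simpa using hn)).trans
    (single_le_sum_of_canonicallyOrdered (f := fun i => lineSum k n (subtreeAt [i] ξ))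
      (mem_range.2 hi))

/-- Markov's inequality for the sum over generation `n + 1` of the moments of the hitting
probabilities. -/
lemma poissonLaw_le_iSup_hitRootProb_le (r : ℝ≥0) {k : ℕ} (hk : 0 < k) {b : ℝ≥0∞}
    (hb0 : b ≠ 0) (hb : b ≠ ⊤) (n : ℕ) :
    poissonLaw r {ξ | b ≤ ⨆ (y : Vertex ξ) (_ : y.generation = n + 1), hitRootProb ξ y}
      ≤ r * (r * hitMoment r k) ^ n / b ^ k := by
  have hm : Measurable fun ξ : List ℕ → ℕ =>
      ∑ i ∈ range (ξ []), lineSum k n (subtreeAt [i] ξ) :=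
    (measurable_sum_prod (F := fun i (ω : ℕ → List ℕ → ℕ) => lineSum k n (ω i))
      fun i => by fun_prop).comp measurable_offspring
  rw [← lintegral_lineSum, ← lintegral_sum_subtreeAt r (by fun_prop)]
  refine (measure_mono fun ξ hξ => ?_).trans
    (meas_ge_le_lintegral_div hm.aemeasurable (pow_ne_zero k hb0) (ENNReal.pow_ne_top hb))
  have hle : b ≤ (∑ i ∈ range (ξ []), lineSum k n (subtreeAt [i] ξ)) ^ (k : ℝ)⁻¹ := by
    refine le_trans hξ (iSup₂_le fun y hy => (hitRootProb_le ξ y).trans ?_)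
    rw [ENNReal.le_rpow_inv_iff (by exact_mod_cast hk), ENNReal.rpow_natCast]
    exact_mod_cast hitLine_pow_le k n ξ y.1 y.2 hy
  rwa [ENNReal.le_rpow_inv_iff (by exact_mod_cast hk), ENNReal.rpow_natCast] at hle

/-- The generation `n + 1` is empty if the root has no children. -/
lemma poissonLaw_le_iSup_hitRootProb_le_one_sub (r : ℝ≥0) {b : ℝ≥0∞} (hb0 : b ≠ 0) (n : ℕ) :
    poissonLaw r {ξ | b ≤ ⨆ (y : Vertex ξ) (_ : y.generation = n + 1), hitRootProb ξ y}
      ≤ ENNReal.ofReal (1 - Real.exp (-r)) := by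
  have hm : MeasurableSet {ξ : List ℕ → ℕ | ξ [] = 0} :=
    measurable_pi_apply [] (measurableSet_singleton 0)
  have h0 : poissonLaw r {ξ | ξ [] = 0} = ENNReal.ofReal (Real.exp (-r)) := by
    have h := measurePreserving_eval_infinitePi (fun _ : List ℕ => poissonMeasure r) []
    have h' := h.measure_preimage (measurableSet_singleton 0).nullMeasurableSet
    rw [poissonMeasure_singleton, pow_zero, mul_one, Nat.factorial_zero, Nat.cast_one,
      div_one] at h'
    exact h'
  rw [ENNReal.ofReal_sub _ (Real.exp_pos _).le, ENNReal.ofReal_one, ← h0,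
    ← prob_compl_eq_one_sub hm]
  refine measure_mono fun ξ hξ h => hb0 ?_
  refine le_antisymm (le_trans hξ (iSup₂_le fun y hy => ?_)) zero_le
  obtain ⟨v, hv⟩ := y
  obtain rfl | ⟨u, i, rfl⟩ := v.eq_nil_or_concat
  · simp [Vertex.generation] at hy
  · rw [List.concat_eq_append] at hv
    have := ((isIndividual_append ξ u i).1 hv).1
    rw [show ξ [] = 0 from h] at this
    omega

end GaltonWatson

/-- A sequence that is at most `q < 1` and at most `A * exp (-c * l)` is at most
`exp (-c' * l)` for some `c' > 0`. -/
lemma Real.exists_pos_forall_min_le_exp {A c q : ℝ} (hc : 0 < c) (hq : q < 1) :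
    ∃ c' : ℝ, 0 < c' ∧ ∀ l : ℕ, min q (A * Real.exp (-c * l)) ≤ Real.exp (-c' * l) := by
  obtain ⟨d, hd, hqd⟩ : ∃ d : ℝ, 0 < d ∧ q ≤ Real.exp (-d) := by
    have h : Filter.Tendsto (fun d : ℝ => Real.exp (-d)) (nhdsWithin 0 (Set.Ioi 0)) (nhds 1) := by
      have : Continuous fun d : ℝ => Real.exp (-d) := by fun_prop
      simpa using (this.tendsto 0).mono_left nhdsWithin_le_nhds
    obtain ⟨d, hd, hd0⟩ := ((h.eventually_const_lt hq).and self_mem_nhdsWithin).exists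
    exact ⟨d, hd0, hd.le⟩
  set b := |A| + 1 with hb
  have hb0 : 0 < b := by positivity
  have hAb : A ≤ Real.exp b := by
    have := Real.add_one_le_exp b
    have := le_abs_self A
    linarith
  refine ⟨min (c / 2) (d * c / (2 * b)), by positivity, fun l => ?_⟩
  have hl : (0 : ℝ) ≤ l := l.cast_nonneg
  by_cases hbl : b ≤ c / 2 * l
  · refine (min_le_right _ _).trans ?_
    calc A * Real.exp (-c * l) ≤ Real.exp b * Real.exp (-c * l) := by gcongr
      _ = Real.exp (b + -c * l) := (Real.exp_add _ _).symm
      _ ≤ _ := by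
        have := mul_le_mul_of_nonneg_right (min_le_left (c / 2) (d * c / (2 * b))) hl
        rw [Real.exp_le_exp]
        linarith
  · refine (min_le_left _ _).trans (hqd.trans ?_)
    rw [Real.exp_le_exp]
    have h1 := mul_le_mul_of_nonneg_right (min_le_right (c / 2) (d * c / (2 * b))) hl
    have h2 : d * c / (2 * b) * l = d / b * (c / 2 * l) := by
      field_simp
    have h3 : d / b * (c / 2 * l) ≤ d / b * b := by
      have := (not_le.1 hbl).le
      gcongr
    rw [div_mul_cancel₀ _ hb0.ne'] at h3
    linarith

theorem proposition10p5 (lam : ℝ≥0) (hlam : 1 < lam) :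
    ∃ c₁ c₂ : ℝ, 0 < c₁ ∧ 0 < c₂ ∧ ∀ l : ℕ, 1 ≤ l →
      GaltonWatson.poissonLaw lam
          {ξ | ENNReal.ofReal (Real.exp (-c₁ * l)) ≤
            ⨆ (y : GaltonWatson.Vertex ξ) (_ : y.generation = l),
              GaltonWatson.hitRootProb ξ y}
        ≤ ENNReal.ofReal (Real.exp (-c₂ * l)) := by
  obtain ⟨k, hk, hρ⟩ := GaltonWatson.exists_mul_hitMoment_lt_one hlam
  obtain ⟨c, hc, hρc⟩ : ∃ c : ℝ, 0 < c ∧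
      lam * GaltonWatson.hitMoment lam k ≤ ENNReal.ofReal (Real.exp (-c)) := by
    obtain ⟨s, hs1, hs2⟩ := exists_between hρ
    have hs0 : s ≠ 0 := hs1.ne_bot
    have hst : s ≠ ⊤ := hs2.ne_top
    have hs : 0 < s.toReal := ENNReal.toReal_pos hs0 hst
    refine ⟨-Real.log s.toReal, ?_, ?_⟩
    · rw [neg_pos]
      exact Real.log_neg hs (by simpa using (ENNReal.toReal_lt_toReal hst ENNReal.one_ne_top).2 hs2)
    · rw [neg_neg, Real.exp_log hs, ENNReal.ofReal_toReal hst]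
      exact hs1.le
  have hk' : (0 : ℝ) < k := by exact_mod_cast hk
  obtain ⟨c₂, hc₂, hmin⟩ := Real.exists_pos_forall_min_le_exp (A := lam * Real.exp c)
    (c := c / 2) (q := 1 - Real.exp (-lam)) (by positivity) (by linarith [Real.exp_pos (-lam)])
  refine ⟨c / (2 * k), c₂, by positivity, hc₂, fun l hl => ?_⟩
  obtain ⟨n, rfl⟩ := Nat.exists_eq_add_of_le' hl
  have hb0 : ENNReal.ofReal (Real.exp (-(c / (2 * k)) * (n + 1 : ℕ))) ≠ 0 := by
    simpa using Real.exp_pos _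
  refine le_trans ?_ (ENNReal.ofReal_le_ofReal (hmin (n + 1)))
  rw [ENNReal.ofReal_min]
  refine le_min (GaltonWatson.poissonLaw_le_iSup_hitRootProb_le_one_sub lam hb0 n) ?_
  refine (GaltonWatson.poissonLaw_le_iSup_hitRootProb_le lam hk hb0 ENNReal.ofReal_ne_top n).trans ?_
  calc lam * (lam * GaltonWatson.hitMoment lam k) ^ n
        / ENNReal.ofReal (Real.exp (-(c / (2 * k)) * (n + 1 : ℕ))) ^ k
      ≤ lam * ENNReal.ofReal (Real.exp (-c)) ^ n
        / ENNReal.ofReal (Real.exp (-(c / (2 * k)) * (n + 1 : ℕ))) ^ k := by gcongr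
    _ = ENNReal.ofReal (lam * Real.exp (-c) ^ n
        / Real.exp (-(c / (2 * k)) * (n + 1 : ℕ)) ^ k) := by
      rw [ENNReal.ofReal_div_of_pos (by positivity), ENNReal.ofReal_mul lam.coe_nonneg,
        ENNReal.ofReal_pow (by positivity), ENNReal.ofReal_pow (by positivity),
        ENNReal.ofReal_coe_nnreal]
    _ = _ := by
      congr 1
      rw [← Real.exp_nat_mul, ← Real.exp_nat_mul, mul_div_assoc, ← Real.exp_sub, mul_assoc,
        ← Real.exp_add]
      congr 2
      push_cast
      field_simp
      ring
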